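/- Let $\beta\in(1,2]$, $\sigma>0$ and $m_{2\beta}$ be real numbers. There exist constants $C>0$ and $c_0>0$, depending only on $(m_{2\beta},\sigma,\beta)$, such that the following holds for every $\epsilon\in(0,1/4)$ and every natural number $n\ge C[\log(\epsilon^{-1})+1]$. First, $c_0\big(\tfrac{\log(\epsilon^{-1})}{n}\big)^{\frac{\beta-1}{\beta}}<1$. Second, let $\psi_1,\psi_2:\mathbb{R}\to\mathbb{R}$ be any continuous non-decreasing functions satisfying, for all $x\in\mathbb{R}$, $$-\log\Big(1-x+\tfrac{|x|^2}{2}\Big)\le\psi_1(x)\le\log\Big(1+x+\tfrac{|x|^2}{2}\Big),\qquad -\log\Big(1-x+\tfrac{|x|^\beta}{\beta}\Big)\le\psi_2(x)\le\log\Big(1+x+\tfrac{|x|^\beta}{\beta}\Big),$$ and let $X_1,\dots,X_n$ be i.i.d. real random variables with $\mathbb{E}[X_i]=\mu$, $\mathbb{E}|X_i-\mu|^2=\sigma^2$ and $\mathbb{E}|X_i-\mu|^{2\beta}=m_{2\beta}<\infty$. Put $$\alpha_1=\sqrt{\tfrac{\log(n^{\frac1\beta-\frac12}\epsilon^{-1})}{n}},\qquad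 \alpha_2=\Big(\tfrac{\log(\epsilon^{-1})}{n}\Big)^{\frac1\beta}.$$ Then there exist measurable functions $\hat\theta,\hat v$ of the sample $(X_1,\dots,X_n)$ such that, with probability at least $1-4\epsilon$, all of the following hold: $\hat v>0$ and $(\hat\theta,\hat v)$ solves the coupled equations $$f_1(\theta,v)=\frac1n\sum_{i=1}^n\psi_1\Big(\alpha_1\frac{X_i-\theta}{v}\Big)=0,\qquad f_2(\theta,v)=\frac1n\sum_{i=1}^n\psi_2\Big(\alpha_2\Big(\frac{(X_i-\theta)^2}{v^2}-1\Big)\Big)=0;$$ $$|\hat\theta-\mu|\le 6\sigma\sqrt{\tfrac{\log(n^{\frac1\beta-\frac12}\epsilon^{-1})}{n}};$$ $$\Big(1+c_0\big(\tfrac{\log(\epsilon^{-1})}{n}\big)^{\frac{\beta-1}{\beta}}\Big)^{-\frac12}\sigma\le\hat v\le\Big(1-c_0\big(\tfrac{\log(\epsilon^{-1})}{n}\big)^{\frac{\beta-1}{\beta}}\Big)^{-\frac12}\sigma.$$ -/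

import Mathlib

open MeasureTheory ProbabilityTheory

noncomputable section

/-- Catoni-type influence functions of order `γ`: continuous non-decreasing functions with
`-log (1 - x + |x|^γ / γ) ≤ ψ x ≤ log (1 + x + |x|^γ / γ)`.
At `x = 0` both bounds vanish, so `ψ 0 = 0` is automatic. For `γ = 2` the bounds are
`log (1 ± x + x² / 2)`. -/
structure IsCatoniType (γ : ℝ) (ψ : ℝ → ℝ) : Prop where
  continuous : Continuous ψ
  monotone : Monotone ψ
  lower : ∀ x : ℝ, -Real.log (1 - x + |x| ^ γ / γ) ≤ ψ x
  upper : ∀ x : ℝ, ψ x ≤ Real.log (1 + x + |x| ^ γ / γ)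

/-- The scale `α₁ = √(log (n^(1/β - 1/2) ε⁻¹) / n)`. -/
def catoniAlpha₁ (n : ℕ) (β ε : ℝ) : ℝ :=
  Real.sqrt (Real.log ((n : ℝ) ^ (1 / β - 1 / 2) * ε⁻¹) / n)

/-- The scale `α₂ = (log ε⁻¹ / n)^(1/β)`. -/
def catoniAlpha₂ (n : ℕ) (β ε : ℝ) : ℝ :=
  (Real.log ε⁻¹ / n) ^ (1 / β)

/-- `f₁(θ, v) = (1/n) ∑ ψ₁ (α₁ (xᵢ - θ) / v)` for the sample `x`. -/
def catoniF₁ {n : ℕ} (ψ₁ : ℝ → ℝ) (β ε : ℝ) (x : Fin n → ℝ) (θ v : ℝ) : ℝ :=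
  (1 / (n : ℝ)) * ∑ i, ψ₁ (catoniAlpha₁ n β ε * ((x i - θ) / v))

/-- `f₂(θ, v) = (1/n) ∑ ψ₂ (α₂ ((xᵢ - θ)² / v² - 1))` for the sample `x`. -/
def catoniF₂ {n : ℕ} (ψ₂ : ℝ → ℝ) (β ε : ℝ) (x : Fin n → ℝ) (θ v : ℝ) : ℝ :=
  (1 / (n : ℝ)) * ∑ i, ψ₂ (catoniAlpha₂ n β ε * ((x i - θ) ^ 2 / v ^ 2 - 1))

/-- `(θ, v)`, with `v > 0`, solves the coupled equations `f₁ = f₂ = 0` for the sample `x`. -/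
def IsJointCatoniSolution {n : ℕ} (ψ₁ ψ₂ : ℝ → ℝ) (β ε : ℝ) (x : Fin n → ℝ) (θ v : ℝ) : Prop :=
  0 < v ∧ catoniF₁ ψ₁ β ε x θ v = 0 ∧ catoniF₂ ψ₂ β ε x θ v = 0

end

/-! Write `k = (log ε⁻¹ / n)^((β-1)/β)` and `κ = c₀ k`. Consider the rectangle `|θ - μ| ≤ 6σα₁`,
with `v` between the two claimed bounds, so that `σ²/v²` runs over `[1 - κ, 1 + κ]`. If `f₁` is
nonnegative on the left side and nonpositive on the right, and `f₂` is nonnegative at the bottom and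
nonpositive at the top, a Poincaré–Miranda argument (`exists_common_zero_of_antitoneOn`) gives a
common zero inside, and the error bounds hold because it lies there. It remains to choose the zero
measurably and to show that the sign pattern is likely.

Each sign comes from Chernoff's bound: `exp (ψ x) ≤ 1 + x + |x|^γ / γ` needs only a moment of order
`γ` of the argument. The difficulty is uniformity along a whole side. On the horizontal sides,
moving `θ` changes the square in a controlled way and `ψ₂` is monotone, so one sum dominates all
`θ`. On the vertical sides the argument is `y τ` with `τ = σ/v` and `y` of either sign, so
monotonicity does not help. However, `τ ↦ log (1 + yτ + (yτ)²/2)` is convex up to an error of order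
`(b - a)² log (1 + y²)` on `[a, b]`, so the two endpoints and one further sum control every `v`
(`sum_le_of_sum_log_quadratic_le`).

The scales match: `α₁ ≤ (5/4) k` and `α₂ k = α₂^β = log ε⁻¹ / n`, so a large `c₀` makes the drift
`-α₂ κ` beat every error term. -/

/-! ### Measurable selection from closed sets with bounded fibres -/

theorem isClosed_image_fst_of_fiber_mem_Icc {X : Type*} [TopologicalSpace X] {K : Set (X × ℝ)}
    {a b : ℝ} (hK : IsClosed K) (hb : ∀ p ∈ K, p.2 ∈ Set.Icc a b) :
    IsClosed (Prod.fst '' K) := by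
  have hc : IsClosed ((fun p : X × Set.Icc a b => (p.1, (p.2 : ℝ))) ⁻¹' K) :=
    hK.preimage (by fun_prop)
  have := isClosedMap_fst_of_compactSpace (X := X) (Y := Set.Icc a b) _ hc
  convert this using 1
  ext x
  constructor
  · rintro ⟨p, hp, rfl⟩
    exact ⟨(p.1, ⟨p.2, hb p hp⟩), hp, rfl⟩
  · rintro ⟨p, hp, rfl⟩
    exact ⟨(p.1, (p.2 : ℝ)), hp, rfl⟩

/-- A closed set with uniformly bounded real fibres has a measurable selection. -/
theorem exists_measurable_selection_of_isClosed {X : Type*} [TopologicalSpace X]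
    [MeasurableSpace X] [BorelSpace X] {K : Set (X × ℝ)} {a b : ℝ} (hK : IsClosed K)
    (hb : ∀ p ∈ K, p.2 ∈ Set.Icc a b) :
    ∃ f : X → ℝ, Measurable f ∧ ∀ x ∈ Prod.fst '' K, (x, f x) ∈ K := by
  have hcl : ∀ x, IsClosed {t | (x, t) ∈ K} := fun x => hK.preimage (by fun_prop)
  have hbd : ∀ x, BddBelow {t | (x, t) ∈ K} := fun x => ⟨a, fun t ht => (hb _ ht).1⟩
  have hmem : ∀ x ∈ Prod.fst '' K, (x, sInf {t | (x, t) ∈ K}) ∈ K := by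
    rintro _ ⟨p, hp, rfl⟩
    exact (hcl p.1).csInf_mem ⟨p.2, hp⟩ (hbd p.1)
  refine ⟨fun x => sInf {t | (x, t) ∈ K}, measurable_of_Iic fun c => ?_, hmem⟩
  -- A sublevel set of the infimum is a projection of a closed set. Off the projection the fibre is
  -- empty and `sInf ∅ = 0`, which gives the second piece.
  have hE : (fun x => sInf {t | (x, t) ∈ K}) ⁻¹' Set.Iic c =
      Prod.fst '' (K ∩ {p | p.2 ≤ c}) ∪ ((Prod.fst '' K)ᶜ ∩ {_x | (0 : ℝ) ≤ c}) := by
    ext x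
    by_cases hx : x ∈ Prod.fst '' K
    · constructor
      · intro h
        exact Or.inl ⟨(x, _), ⟨hmem x hx, h⟩, rfl⟩
      · rintro (⟨p, ⟨hp, hpc⟩, rfl⟩ | h)
        · exact (csInf_le (hbd p.1) hp).trans hpc
        · exact absurd hx h.1
    · have h0 : {t | (x, t) ∈ K} = ∅ := by
        ext t
        simp only [Set.mem_ofPred_eq, Set.mem_empty_iff_false, iff_false]
        exact fun ht => hx ⟨_, ht, rfl⟩
      constructor
      · intro h
        refine Or.inr ⟨hx, ?_⟩
        simpa [h0] using h
      · rintro (⟨p, ⟨hp, hpc⟩, rfl⟩ | h)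
        · exact absurd ⟨p, hp, rfl⟩ hx
        · simpa [h0] using h.2
  rw [hE]
  refine MeasurableSet.union ?_ (MeasurableSet.inter ?_ (MeasurableSet.const _))
  · refine (isClosed_image_fst_of_fiber_mem_Icc (a := a) (b := b)
      (hK.inter (isClosed_le (by fun_prop) (by fun_prop))) fun p hp => hb p hp.1).measurableSet
  · exact (isClosed_image_fst_of_fiber_mem_Icc hK hb).measurableSet.compl

/-- Lexicographic choice: the first coordinate is selected from the closed projection, then the
second from the fibre above it. -/
theorem exists_measurable_selection_prod {X : Type*} [TopologicalSpace X]
    [SecondCountableTopology X] [MeasurableSpace X] [BorelSpace X] {K : Set ((X × ℝ) × ℝ)}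
    {a b c d : ℝ} (hK : IsClosed K)
    (hb : ∀ p ∈ K, p.1.2 ∈ Set.Icc a b ∧ p.2 ∈ Set.Icc c d) :
    ∃ f g : X → ℝ, Measurable f ∧ Measurable g ∧
      ∀ x, (∃ s t, ((x, s), t) ∈ K) → ((x, f x), g x) ∈ K := by
  obtain ⟨g, hg, hgK⟩ := exists_measurable_selection_of_isClosed hK fun p hp => (hb p hp).2
  obtain ⟨f, hf, hfK⟩ := exists_measurable_selection_of_isClosed (a := a) (b := b)
    (isClosed_image_fst_of_fiber_mem_Icc hK fun p hp => (hb p hp).2)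
    (by rintro _ ⟨p, hp, rfl⟩; exact (hb p hp).1)
  refine ⟨f, fun x => g (x, f x), hf, hg.comp (measurable_id.prodMk hf), ?_⟩
  rintro x ⟨s, t, h⟩
  exact hgK _ (hfK x ⟨(x, s), ⟨_, h, rfl⟩, rfl⟩)

/-! ### Common zeros on a rectangle -/

/-- A planar Poincaré–Miranda theorem, for a first component that is monotone in the first
variable. -/
theorem exists_common_zero_of_antitoneOn {F G : ℝ × ℝ → ℝ} {a b c d : ℝ} (hab : a ≤ b)
    (hcd : c ≤ d) (hF : ContinuousOn F (Set.Icc a b ×ˢ Set.Icc c d))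
    (hG : ContinuousOn G (Set.Icc a b ×ˢ Set.Icc c d))
    (hmono : ∀ v ∈ Set.Icc c d, AntitoneOn (fun t => F (t, v)) (Set.Icc a b))
    (hFa : ∀ v ∈ Set.Icc c d, 0 ≤ F (a, v)) (hFb : ∀ v ∈ Set.Icc c d, F (b, v) ≤ 0)
    (hGc : ∀ t ∈ Set.Icc a b, 0 ≤ G (t, c)) (hGd : ∀ t ∈ Set.Icc a b, G (t, d) ≤ 0) :
    ∃ t ∈ Set.Icc a b, ∃ v ∈ Set.Icc c d, F (t, v) = 0 ∧ G (t, v) = 0 := by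
  have hRc : IsCompact (Set.Icc a b ×ˢ Set.Icc c d) := isCompact_Icc.prod isCompact_Icc
  have hFv : ∀ v ∈ Set.Icc c d, ContinuousOn (fun t => F (t, v)) (Set.Icc a b) := fun v hv =>
    hF.comp (by fun_prop) fun t ht => ⟨ht, hv⟩
  have hGv : ∀ v ∈ Set.Icc c d, ContinuousOn (fun t => G (t, v)) (Set.Icc a b) := fun v hv =>
    hG.comp (by fun_prop) fun t ht => ⟨ht, hv⟩
  have hzero : ∀ v ∈ Set.Icc c d, ∃ t ∈ Set.Icc a b, F (t, v) = 0 := fun v hv =>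
    intermediate_value_Icc' hab (hFv v hv) ⟨hFb v hv, hFa v hv⟩
  have hclosed : ∀ S : Set (ℝ × ℝ), IsClosed S → IsClosed (Prod.snd ''
      ((Set.Icc a b ×ˢ Set.Icc c d) ∩ (fun p => (F p, G p)) ⁻¹' S)) := by
    intro S hS
    have h1 : IsClosed ((Set.Icc a b ×ˢ Set.Icc c d) ∩ (fun p => (F p, G p)) ⁻¹' S) :=
      (hF.prodMk hG).preimage_isClosed_of_isClosed hRc.isClosed hS
    exact ((hRc.of_isClosed_subset h1 Set.inter_subset_left).image continuous_snd).isClosed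
  have hS1 : IsClosed {p : ℝ × ℝ | p.1 = 0 ∧ 0 ≤ p.2} :=
    (isClosed_eq continuous_fst continuous_const).inter
      (isClosed_le continuous_const continuous_snd)
  have hS2 : IsClosed {p : ℝ × ℝ | p.1 = 0 ∧ p.2 ≤ 0} :=
    (isClosed_eq continuous_fst continuous_const).inter
      (isClosed_le continuous_snd continuous_const)
  -- The heights at which some zero of `F` has `G ≥ 0`, and those at which some zero has `G ≤ 0`,
  -- form closed sets covering a connected interval, so they meet.
  obtain ⟨v, hv, ⟨⟨s, v1⟩, ⟨⟨hs, -⟩, hFs, hGs⟩, hv1⟩, ⟨⟨t, v2⟩, ⟨⟨ht, -⟩, hFt, hGt⟩, hv2⟩⟩ :=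
      isPreconnected_closed_iff.mp (isPreconnected_Icc (a := c) (b := d)) _ _
        (hclosed _ hS1) (hclosed _ hS2)
      (by
        intro v hv
        obtain ⟨t, ht, h0⟩ := hzero v hv
        rcases le_total 0 (G (t, v)) with h | h
        · exact Or.inl ⟨(t, v), ⟨⟨ht, hv⟩, h0, h⟩, rfl⟩
        · exact Or.inr ⟨(t, v), ⟨⟨ht, hv⟩, h0, h⟩, rfl⟩)
      (by
        have hc : c ∈ Set.Icc c d := Set.left_mem_Icc.2 hcd
        obtain ⟨t, ht, h0⟩ := hzero c hc
        exact ⟨c, hc, (t, c), ⟨⟨ht, hc⟩, h0, hGc t ht⟩, rfl⟩)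
      (by
        have hd : d ∈ Set.Icc c d := Set.right_mem_Icc.2 hcd
        obtain ⟨t, ht, h0⟩ := hzero d hd
        exact ⟨d, hd, (t, d), ⟨⟨ht, hd⟩, h0, hGd t ht⟩, rfl⟩)
  simp only at hv1 hv2 hFs hFt hGs hGt hs ht
  subst hv1 hv2
  -- Between two zeros at the same height `F` vanishes identically by monotonicity, while `G`
  -- changes sign there.
  have hsub : Set.uIcc t s ⊆ Set.Icc a b := Set.uIcc_subset_Icc ht hs
  obtain ⟨r, hr, hGr⟩ := intermediate_value_uIcc ((hGv _ hv).mono hsub)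
    (Set.mem_uIcc.2 (Or.inl ⟨hGt, hGs⟩))
  refine ⟨r, hsub hr, _, hv, ?_, hGr⟩
  rcases Set.mem_uIcc.1 hr with ⟨h1, h2⟩ | ⟨h1, h2⟩
  · have e1 := hmono _ hv ht (hsub hr) h1
    have e2 := hmono _ hv (hsub hr) hs h2
    simp only at e1 e2
    linarith
  · have e1 := hmono _ hv hs (hsub hr) h1
    have e2 := hmono _ hv (hsub hr) ht h2
    simp only at e1 e2
    linarith

/-! ### Exponential moments of influence functions -/

/-- Chernoff's bound for a sum whose exponential moments are dominated by `1 + c`. -/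
theorem measureReal_le_exp_of_exp_le {Ω ι : Type*} [MeasurableSpace Ω] [Fintype ι]
    {P : Measure Ω} [IsProbabilityMeasure P] {X : ι → Ω → ℝ} (hX : ∀ i, Measurable (X i))
    (hind : iIndepFun X P) {g h : ℝ → ℝ} (hg : Measurable g)
    (hgh : ∀ x, Real.exp (g x) ≤ h x) {c T : ℝ}
    (hint : ∀ i, Integrable (fun ω => h (X i ω)) P)
    (hc : ∀ i, ∫ ω, h (X i ω) ∂P ≤ 1 + c) :
    P.real {ω | Fintype.card ι * c + T ≤ ∑ i, g (X i ω)} ≤ Real.exp (-T) := by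
  have hgm : ∀ i, Measurable (fun ω => g (X i ω)) := fun i => hg.comp (hX i)
  have hgi : iIndepFun (fun i ω => g (X i ω)) P := hind.comp (fun _ => g) fun _ => hg
  have hexp : ∀ i, Integrable (fun ω => Real.exp (1 * g (X i ω))) P := fun i =>
    (hint i).mono' ((hgm i).const_mul 1).exp.aestronglyMeasurable (ae_of_all _ fun ω => by
      rw [one_mul, Real.norm_eq_abs, abs_of_pos (Real.exp_pos _)]; exact hgh _)
  have key := measure_ge_le_exp_mul_mgf (X := ∑ i, fun ω => g (X i ω)) (μ := P) (t := 1)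
    (Fintype.card ι * c + T) zero_le_one
    (hgi.integrable_exp_mul_sum hgm fun i _ => hexp i)
  rw [hgi.mgf_sum hgm] at key
  have hprod : ∏ i, mgf (fun ω => g (X i ω)) P 1 ≤ Real.exp (Fintype.card ι * c) := by
    calc ∏ i, mgf (fun ω => g (X i ω)) P 1 ≤ ∏ _i : ι, Real.exp c := by
          refine Finset.prod_le_prod (fun i _ => mgf_nonneg) fun i _ => ?_
          calc mgf (fun ω => g (X i ω)) P 1 ≤ ∫ ω, h (X i ω) ∂P :=
                integral_mono (hexp i) (hint i) fun ω => by
                  simpa using hgh (X i ω)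
            _ ≤ 1 + c := hc i
            _ ≤ Real.exp c := by linarith [Real.add_one_le_exp c]
      _ = Real.exp (Fintype.card ι * c) := by
          rw [Finset.prod_const, ← Real.exp_nat_mul, Finset.card_univ]
  calc P.real {ω | Fintype.card ι * c + T ≤ ∑ i, g (X i ω)}
      ≤ Real.exp (-1 * (Fintype.card ι * c + T)) * ∏ i, mgf (fun ω => g (X i ω)) P 1 := by
        simpa [Finset.sum_apply] using key
    _ ≤ Real.exp (-1 * (Fintype.card ι * c + T)) * Real.exp (Fintype.card ι * c) := by gcongr
    _ = Real.exp (-T) := by rw [← Real.exp_add]; congr 1; ring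

/-- Bernoulli's inequality gives `|x|^γ / γ ≥ 1/γ + |x| - 1`. Positivity is what allows the
logarithmic upper bound on `ψ` to be exponentiated. -/
theorem one_add_add_abs_rpow_div_pos {γ : ℝ} (hγ : 1 ≤ γ) (x : ℝ) :
    0 < 1 + x + |x| ^ γ / γ := by
  have h := one_add_mul_self_le_rpow_one_add (s := |x| - 1) (by linarith [abs_nonneg x]) hγ
  have h2 : (1 + γ * (|x| - 1)) / γ ≤ |x| ^ γ / γ := by
    gcongr
    simpa using h
  have h3 : (1 + γ * (|x| - 1)) / γ = 1 / γ + |x| - 1 := by field_simp; ring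
  have h4 : 0 < 1 / γ := by positivity
  linarith [neg_abs_le x]

theorem IsCatoniType.exp_le {γ : ℝ} {ψ : ℝ → ℝ} (h : IsCatoniType γ ψ) (hγ : 1 ≤ γ) (x : ℝ) :
    Real.exp (ψ x) ≤ 1 + x + |x| ^ γ / γ := by
  rw [← Real.le_log_iff_exp_le (one_add_add_abs_rpow_div_pos hγ x)]
  exact h.upper x

/-- This symmetry turns each upper-tail estimate into the corresponding lower-tail one. -/
theorem IsCatoniType.reflect {γ : ℝ} {ψ : ℝ → ℝ} (h : IsCatoniType γ ψ) :
    IsCatoniType γ fun x => -ψ (-x) where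
  continuous := (h.continuous.comp continuous_neg).neg
  monotone := fun _ _ hxy => neg_le_neg (h.monotone (neg_le_neg hxy))
  lower x := by
    have := h.upper (-x)
    rw [abs_neg] at this
    simpa [sub_eq_add_neg] using this
  upper x := by
    have := h.lower (-x)
    rw [abs_neg, sub_neg_eq_add] at this
    linarith

theorem one_add_add_sq_half_pos (x : ℝ) : 0 < 1 + x + x ^ 2 / 2 := by
  nlinarith [sq_nonneg (x + 1)]

theorem IsCatoniType.le_log_quadratic {ψ : ℝ → ℝ} (h : IsCatoniType 2 ψ) (x : ℝ) :
    ψ x ≤ Real.log (1 + x + x ^ 2 / 2) := by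
  have := h.upper x
  rwa [Real.rpow_two, sq_abs] at this

/-! ### Near-convexity of the logarithmic envelope in the scale -/

/-- The logarithm lies above its chords up to a second-order error. -/
theorem log_chord_le {p r t : ℝ} (hp : 0 < p) (hr : 0 < r) (ht0 : 0 ≤ t) (ht1 : t ≤ 1)
    (h : 1 / 2 ≤ r / p) :
    Real.log ((1 - t) * p + t * r) ≤
      (1 - t) * Real.log p + t * Real.log r + 2 * (r / p - 1) ^ 2 := by
  obtain ⟨u, rfl⟩ : ∃ u, r = p * (1 + u) := ⟨r / p - 1, by field_simp; ring⟩
  rw [mul_div_cancel_left₀ _ hp.ne'] at h ⊢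
  have hu1 : 0 < 1 + u := by linarith
  have htu : 0 < 1 + t * u := by nlinarith
  -- This needs `u ≥ -1/2`: the difference `u/(1+u) - (u - 2u²)` equals `u²(1+2u)/(1+u)`.
  have hlu : u - 2 * u ^ 2 ≤ Real.log (1 + u) := by
    have h1 := Real.one_sub_inv_le_log_of_pos hu1
    have h2 : 1 - (1 + u)⁻¹ = u / (1 + u) := by field_simp; ring
    have h3 : u - 2 * u ^ 2 ≤ u / (1 + u) := by
      rw [le_div_iff₀ hu1]
      linarith [mul_nonneg (sq_nonneg u) (by linarith : 0 ≤ 1 + 2 * u)]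
    linarith
  have e : (1 - t) * p + t * (p * (1 + u)) = p * (1 + t * u) := by ring
  rw [e, Real.log_mul hp.ne' htu.ne', Real.log_mul hp.ne' hu1.ne', add_sub_cancel_left]
  have h5 : Real.log (1 + t * u) ≤ t * u := by linarith [Real.log_le_sub_one_of_pos htu]
  have h6 := mul_le_mul_of_nonneg_left hlu ht0
  have h7 := mul_le_mul_of_nonneg_right ht1 (sq_nonneg u)
  linarith

/-- The numerator of the relative increment is `(b - a)(y + y²(a+b)/2)` and the denominator is at
least `(1 + y²)/8`, whence `192 = 3 · 8²`. The factor `y²/(1+y²)` matters: it is below `log (1 +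
y²)`, whose exponential needs only a second moment. -/
theorem sq_quadratic_div_sub_one_le {y a b : ℝ} (ha : 9 / 10 ≤ a) (hab : a ≤ b)
    (hb : b ≤ 11 / 10) :
    ((1 + y * b + (y * b) ^ 2 / 2) / (1 + y * a + (y * a) ^ 2 / 2) - 1) ^ 2 ≤
      192 * (b - a) ^ 2 * (y ^ 2 / (1 + y ^ 2)) := by
  have hp0 := one_add_add_sq_half_pos (y * a)
  have hy0 : 0 < 1 + y ^ 2 := by positivity
  have hp8 : (1 + y ^ 2) / 8 ≤ 1 + y * a + (y * a) ^ 2 / 2 := by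
    have h1 : (1 + (y * a) ^ 2) / 6 ≤ 1 + y * a + (y * a) ^ 2 / 2 := by
      linarith [sq_nonneg (2 * (y * a) + 3)]
    have h2 : y ^ 2 * (81 / 100) ≤ (y * a) ^ 2 := by
      rw [mul_pow]
      exact mul_le_mul_of_nonneg_left (by nlinarith) (sq_nonneg y)
    linarith [sq_nonneg y]
  have e1 : (1 + y * b + (y * b) ^ 2 / 2) / (1 + y * a + (y * a) ^ 2 / 2) - 1 =
      (b - a) * (y + y ^ 2 * ((a + b) / 2)) / (1 + y * a + (y * a) ^ 2 / 2) := by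
    rw [eq_div_iff hp0.ne', sub_mul, div_mul_cancel₀ _ hp0.ne']
    ring
  have e2 : (y + y ^ 2 * ((a + b) / 2)) ^ 2 ≤ 3 * y ^ 2 * (1 + y ^ 2) := by
    have hk : ((a + b) / 2) ^ 2 ≤ 3 / 2 := by nlinarith
    have h4 : 0 ≤ y ^ 4 := by positivity
    linarith [sq_nonneg (y - y ^ 2 * ((a + b) / 2)), mul_le_mul_of_nonneg_left hk h4,
      sq_nonneg y]
  rw [e1, div_pow, mul_pow]
  calc (b - a) ^ 2 * (y + y ^ 2 * ((a + b) / 2)) ^ 2 / (1 + y * a + (y * a) ^ 2 / 2) ^ 2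
      ≤ (b - a) ^ 2 * (3 * y ^ 2 * (1 + y ^ 2)) / ((1 + y ^ 2) / 8) ^ 2 := by gcongr
    _ = 192 * (b - a) ^ 2 * (y ^ 2 / (1 + y ^ 2)) := by field_simp; ring

/-- `τ ↦ log (1 + y τ + (y τ)² / 2)` is dominated by its chord up to a second-order error. -/
theorem log_quadratic_le_chord {y a b t : ℝ} (ha : 9 / 10 ≤ a) (hab : a ≤ b)
    (hb : b ≤ 11 / 10) (hba : b - a ≤ 1 / 40) (ht0 : 0 ≤ t) (ht1 : t ≤ 1) :
    Real.log (1 + y * ((1 - t) * a + t * b) + (y * ((1 - t) * a + t * b)) ^ 2 / 2) ≤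
      (1 - t) * Real.log (1 + y * a + (y * a) ^ 2 / 2) +
        t * Real.log (1 + y * b + (y * b) ^ 2 / 2) +
        384 * (b - a) ^ 2 * Real.log (1 + y ^ 2) := by
  have hy0 : 0 < 1 + y ^ 2 := by positivity
  have hsq := sq_quadratic_div_sub_one_le (y := y) ha hab hb
  have hfrac : y ^ 2 / (1 + y ^ 2) ≤ Real.log (1 + y ^ 2) := by
    have := Real.one_sub_inv_le_log_of_pos hy0
    have h2 : y ^ 2 / (1 + y ^ 2) = 1 - (1 + y ^ 2)⁻¹ := by field_simp; ring
    linarith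
  have hhalf : 1 / 2 ≤ (1 + y * b + (y * b) ^ 2 / 2) / (1 + y * a + (y * a) ^ 2 / 2) := by
    have h1 : y ^ 2 / (1 + y ^ 2) ≤ 1 := by rw [div_le_one hy0]; linarith
    have h2 : (b - a) ^ 2 ≤ 1 / 1600 := by nlinarith
    have h3 : (b - a) ^ 2 * (y ^ 2 / (1 + y ^ 2)) ≤ 1 / 1600 * 1 :=
      mul_le_mul h2 h1 (by positivity) (by norm_num)
    have h4 := abs_le_of_sq_le_sq' (b := 1 / 2) (hsq.trans (by linarith)) (by norm_num)
    linarith [h4.1]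
  -- The quadratic is convex in `τ`, hence below its chord; only the concavity of the logarithm
  -- costs a second-order term.
  have hchord : 1 + y * ((1 - t) * a + t * b) + (y * ((1 - t) * a + t * b)) ^ 2 / 2 ≤
      (1 - t) * (1 + y * a + (y * a) ^ 2 / 2) + t * (1 + y * b + (y * b) ^ 2 / 2) := by
    have e0 : 0 ≤ t * (1 - t) * (y * (b - a)) ^ 2 / 2 := by
      have := sub_nonneg.2 ht1
      positivity
    linarith
  have h1 := Real.log_le_log (one_add_add_sq_half_pos _) hchord
  have h2 := log_chord_le (one_add_add_sq_half_pos (y * a)) (one_add_add_sq_half_pos (y * b))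
    ht0 ht1 hhalf
  have h3 := mul_le_mul_of_nonneg_left hfrac (by positivity : 0 ≤ 192 * (b - a) ^ 2)
  linarith

/-- Replaces a supremum over `τ` by three sums free of `τ`: one for each endpoint and one that pays
for the curvature. -/
theorem sum_le_of_sum_log_quadratic_le {ι : Type*} [Fintype ι] {ψ : ℝ → ℝ}
    (hψ : IsCatoniType 2 ψ) (y : ι → ℝ) {a b τ B S : ℝ} (ha : 9 / 10 ≤ a) (hb : b ≤ 11 / 10)
    (hba : b - a ≤ 1 / 40) (hτ : τ ∈ Set.Icc a b)
    (hBa : ∑ i, Real.log (1 + y i * a + (y i * a) ^ 2 / 2) ≤ B)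
    (hBb : ∑ i, Real.log (1 + y i * b + (y i * b) ^ 2 / 2) ≤ B)
    (hS : ∑ i, Real.log (1 + y i ^ 2) ≤ S) :
    ∑ i, ψ (y i * τ) ≤ B + 384 * (b - a) ^ 2 * S := by
  have hab : a ≤ b := hτ.1.trans hτ.2
  obtain ⟨t, ht0, ht1, rfl⟩ : ∃ t : ℝ, 0 ≤ t ∧ t ≤ 1 ∧ (1 - t) * a + t * b = τ := by
    rw [← segment_eq_Icc hab] at hτ
    obtain ⟨s, t, hs, ht, hst, rfl⟩ := hτ
    exact ⟨t, ht, by linarith, by rw [← hst]; simp⟩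
  calc ∑ i, ψ (y i * ((1 - t) * a + t * b))
      ≤ ∑ i, ((1 - t) * Real.log (1 + y i * a + (y i * a) ^ 2 / 2) +
        t * Real.log (1 + y i * b + (y i * b) ^ 2 / 2) +
        384 * (b - a) ^ 2 * Real.log (1 + y i ^ 2)) :=
        Finset.sum_le_sum fun i _ => (hψ.le_log_quadratic _).trans
          (log_quadratic_le_chord ha hab hb hba ht0 ht1)
    _ = (1 - t) * ∑ i, Real.log (1 + y i * a + (y i * a) ^ 2 / 2) +
        t * ∑ i, Real.log (1 + y i * b + (y i * b) ^ 2 / 2) +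
        384 * (b - a) ^ 2 * ∑ i, Real.log (1 + y i ^ 2) := by
        rw [Finset.sum_add_distrib, Finset.sum_add_distrib, Finset.mul_sum, Finset.mul_sum,
          Finset.mul_sum]
    _ ≤ (1 - t) * B + t * B + 384 * (b - a) ^ 2 * S := by
        have := sub_nonneg.2 ht1
        gcongr
    _ = B + 384 * (b - a) ^ 2 * S := by ring

/-! ### Uniform tail bounds on the four sides of the rectangle -/

section Concentration

variable {Ω ι : Type*} [MeasurableSpace Ω] [Fintype ι] {P : Measure Ω} [IsProbabilityMeasure P]
  {X : ι → Ω → ℝ} {μ σ : ℝ}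

/-- The shift by `6σα` contributes `-6α²c` to the mean, with `c ≥ 9/10`; the quadratic terms leave
at most `-4α²`. Outside the three exceptional events, with `T = 2Nα²`, the endpoint sums are below
`-2Nα²` and the logarithmic sum is below `4Nα²`. The curvature cost is then at most `384 · (1/40)² ·
4Nα² = 0.96Nα²`, too small to restore positivity. -/
theorem measureReal_exists_sum_pos_le (hX : ∀ i, Measurable (X i)) (hind : iIndepFun X P)
    (hint : ∀ i, Integrable (X i) P) (hint2 : ∀ i, Integrable (fun ω => (X i ω - μ) ^ 2) P)
    (hmean : ∀ i, ∫ ω, X i ω ∂P = μ) (hvar : ∀ i, ∫ ω, (X i ω - μ) ^ 2 ∂P = σ ^ 2)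
    (hσ : 0 < σ) {ψ : ℝ → ℝ} (hψ : IsCatoniType 2 ψ) {α a b : ℝ} (hα0 : 0 ≤ α)
    (hα : α ≤ 1 / 10) (ha : 9 / 10 ≤ a) (hab : a ≤ b) (hb : b ≤ 11 / 10)
    (hba : b - a ≤ 1 / 40) :
    P.real {ω | ∃ τ ∈ Set.Icc a b, 0 < ∑ i, ψ (α * ((X i ω - (μ + 6 * σ * α)) / σ) * τ)} ≤
      3 * Real.exp (-(2 * Fintype.card ι * α ^ 2)) := by
  set N : ℝ := (Fintype.card ι : ℝ) with hN
  set T : ℝ := 2 * N * α ^ 2 with hT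
  have hα2 : α ^ 2 ≤ 1 / 100 := by nlinarith
  have hcenter : ∀ i, Integrable (fun ω => X i ω - μ) P := fun i =>
    (hint i).sub (integrable_const μ)
  have hcenter0 : ∀ i, ∫ ω, (X i ω - μ) ∂P = 0 := fun i => by
    rw [integral_sub (hint i) (integrable_const μ), hmean i]; simp
  -- moments of quadratic polynomials in the centred variable
  have hquad : ∀ (p q r : ℝ) (i : ι),
      Integrable (fun ω => p + q * (X i ω - μ) + r * (X i ω - μ) ^ 2) P ∧
      ∫ ω, (p + q * (X i ω - μ) + r * (X i ω - μ) ^ 2) ∂P = p + r * σ ^ 2 := by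
    intro p q r i
    have i1 : Integrable (fun ω => p + q * (X i ω - μ)) P :=
      (integrable_const p).add ((hcenter i).const_mul q)
    refine ⟨i1.add ((hint2 i).const_mul r), ?_⟩
    rw [integral_add i1 ((hint2 i).const_mul r),
      integral_add (integrable_const p) ((hcenter i).const_mul q), integral_const_mul,
      integral_const_mul, hcenter0 i, hvar i]
    simp
  have hend : ∀ c : ℝ, 9 / 10 ≤ c → c ≤ 11 / 10 →
      P.real {ω | N * (-4 * α ^ 2) + T ≤ ∑ i, Real.log (1 +
        α * ((X i ω - (μ + 6 * σ * α)) / σ) * c +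
        (α * ((X i ω - (μ + 6 * σ * α)) / σ) * c) ^ 2 / 2)} ≤ Real.exp (-T) := by
    intro c hc1 hc2
    have hexpand : ∀ x : ℝ, 1 + α * ((x - (μ + 6 * σ * α)) / σ) * c +
        (α * ((x - (μ + 6 * σ * α)) / σ) * c) ^ 2 / 2 =
        (1 - 6 * α ^ 2 * c + 18 * α ^ 4 * c ^ 2) +
          (α * c / σ - 6 * α ^ 3 * c ^ 2 / σ) * (x - μ) +
          (α ^ 2 * c ^ 2 / (2 * σ ^ 2)) * (x - μ) ^ 2 := by
      intro x; field_simp; ring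
    refine measureReal_le_exp_of_exp_le hX hind
      (g := fun x => Real.log (1 + α * ((x - (μ + 6 * σ * α)) / σ) * c +
        (α * ((x - (μ + 6 * σ * α)) / σ) * c) ^ 2 / 2))
      (h := fun x => 1 + α * ((x - (μ + 6 * σ * α)) / σ) * c +
        (α * ((x - (μ + 6 * σ * α)) / σ) * c) ^ 2 / 2)
      (by fun_prop) (fun x => (Real.exp_log (one_add_add_sq_half_pos _)).le) ?_ ?_
    · intro i
      simp only [hexpand]
      exact (hquad _ _ _ i).1
    · intro i
      simp only [hexpand]
      rw [(hquad _ _ _ i).2]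
      have e : α ^ 2 * c ^ 2 / (2 * σ ^ 2) * σ ^ 2 = α ^ 2 * c ^ 2 / 2 := by field_simp
      rw [e]
      have hc3 : c ^ 2 ≤ 121 / 100 := by nlinarith
      have h1 : α ^ 2 * c ^ 2 ≤ α ^ 2 * (121 / 100) :=
        mul_le_mul_of_nonneg_left hc3 (sq_nonneg α)
      have h2 : α ^ 4 * c ^ 2 ≤ 121 / 10000 * α ^ 2 := by
        have : α ^ 4 * c ^ 2 = α ^ 2 * (α ^ 2 * c ^ 2) := by ring
        rw [this]
        nlinarith [sq_nonneg α]
      have h3 : α ^ 2 * (9 / 10) ≤ α ^ 2 * c := mul_le_mul_of_nonneg_left hc1 (sq_nonneg α)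
      nlinarith
  have hlog : P.real {ω | N * (2 * α ^ 2) + T ≤ ∑ i, Real.log (1 +
      (α * ((X i ω - (μ + 6 * σ * α)) / σ)) ^ 2)} ≤ Real.exp (-T) := by
    have hexpand : ∀ x : ℝ, 1 + (α * ((x - (μ + 6 * σ * α)) / σ)) ^ 2 =
        (1 + 36 * α ^ 4) + (-(12 * α ^ 3 / σ)) * (x - μ) + (α ^ 2 / σ ^ 2) * (x - μ) ^ 2 := by
      intro x; field_simp; ring
    refine measureReal_le_exp_of_exp_le hX hind
      (g := fun x => Real.log (1 + (α * ((x - (μ + 6 * σ * α)) / σ)) ^ 2))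
      (h := fun x => 1 + (α * ((x - (μ + 6 * σ * α)) / σ)) ^ 2)
      (by fun_prop) (fun x => (Real.exp_log (by positivity)).le) ?_ ?_
    · intro i
      simp only [hexpand]
      exact (hquad _ _ _ i).1
    · intro i
      simp only [hexpand]
      rw [(hquad _ _ _ i).2]
      have e : α ^ 2 / σ ^ 2 * σ ^ 2 = α ^ 2 := by field_simp
      rw [e]
      nlinarith [sq_nonneg α]
  have hsub : {ω | ∃ τ ∈ Set.Icc a b,
      0 < ∑ i, ψ (α * ((X i ω - (μ + 6 * σ * α)) / σ) * τ)} ⊆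
      ({ω | N * (-4 * α ^ 2) + T ≤ ∑ i, Real.log (1 +
        α * ((X i ω - (μ + 6 * σ * α)) / σ) * a +
        (α * ((X i ω - (μ + 6 * σ * α)) / σ) * a) ^ 2 / 2)} ∪
      {ω | N * (-4 * α ^ 2) + T ≤ ∑ i, Real.log (1 +
        α * ((X i ω - (μ + 6 * σ * α)) / σ) * b +
        (α * ((X i ω - (μ + 6 * σ * α)) / σ) * b) ^ 2 / 2)}) ∪
      {ω | N * (2 * α ^ 2) + T ≤ ∑ i, Real.log (1 +
        (α * ((X i ω - (μ + 6 * σ * α)) / σ)) ^ 2)} := by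
    rintro ω ⟨τ, hτ, hpos⟩
    by_contra hcon
    simp only [Set.mem_union, Set.mem_ofPred_eq, not_or, not_le] at hcon
    obtain ⟨⟨h1, h2⟩, h3⟩ := hcon
    have := sum_le_of_sum_log_quadratic_le hψ
      (fun i => α * ((X i ω - (μ + 6 * σ * α)) / σ)) ha hb hba hτ h1.le h2.le h3.le
    have hNα : 0 ≤ N * α ^ 2 := by positivity
    have hbasq : (b - a) ^ 2 ≤ 1 / 1600 := by nlinarith
    have := mul_le_mul_of_nonneg_right hbasq hNα
    rw [hT] at *
    nlinarith
  calc _ ≤ _ := measureReal_mono hsub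
    _ ≤ Real.exp (-T) + Real.exp (-T) + Real.exp (-T) := by
      refine (measureReal_union_le _ _).trans (add_le_add ?_ hlog)
      exact (measureReal_union_le _ _).trans
        (add_le_add (hend a ha (hab.trans hb)) (hend b (ha.trans hab) hb))
    _ = 3 * Real.exp (-T) := by ring

theorem measureReal_exists_sum_neg_le (hX : ∀ i, Measurable (X i)) (hind : iIndepFun X P)
    (hint : ∀ i, Integrable (X i) P) (hint2 : ∀ i, Integrable (fun ω => (X i ω - μ) ^ 2) P)
    (hmean : ∀ i, ∫ ω, X i ω ∂P = μ) (hvar : ∀ i, ∫ ω, (X i ω - μ) ^ 2 ∂P = σ ^ 2)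
    (hσ : 0 < σ) {ψ : ℝ → ℝ} (hψ : IsCatoniType 2 ψ) {α a b : ℝ} (hα0 : 0 ≤ α)
    (hα : α ≤ 1 / 10) (ha : 9 / 10 ≤ a) (hab : a ≤ b) (hb : b ≤ 11 / 10)
    (hba : b - a ≤ 1 / 40) :
    P.real {ω | ∃ τ ∈ Set.Icc a b, ∑ i, ψ (α * ((X i ω - (μ - 6 * σ * α)) / σ) * τ) < 0} ≤
      3 * Real.exp (-(2 * Fintype.card ι * α ^ 2)) := by
  have key := measureReal_exists_sum_pos_le (X := fun i ω => -X i ω) (μ := -μ) (σ := σ)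
    (P := P) (fun i => (hX i).neg) (hind.comp (fun _ x => -x) fun _ => measurable_neg)
    (fun i => (hint i).neg) (fun i => by simpa [neg_add_eq_sub, sub_sq_comm μ] using hint2 i)
    (fun i => by rw [integral_neg, hmean i])
    (fun i => by simpa [neg_add_eq_sub, sub_sq_comm μ] using hvar i) hσ hψ.reflect hα0 hα ha hab
    hb hba
  convert key using 6 with ω τ
  rw [Finset.sum_neg_distrib, Left.neg_pos_iff]
  congr! 4
  ring

/-- The parameters `p`, `r` accommodate the upper and lower envelopes of the shifted square. With `z
= ((x - μ)/σ)²`, the constant `50 = 25 · 2` comes from `|pz + r| ≤ 5(z + 1)`, `5^β ≤ 25` and `(z +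
1)^β ≤ 2(z^β + 1)`. -/
theorem measureReal_quadratic_le (hX : ∀ i, Measurable (X i)) (hind : iIndepFun X P)
    (hint2 : ∀ i, Integrable (fun ω => (X i ω - μ) ^ 2) P)
    (hvar : ∀ i, ∫ ω, (X i ω - μ) ^ 2 ∂P = σ ^ 2) (hσ : 0 < σ) {β m : ℝ} (hβ : 1 ≤ β)
    (hβ' : β ≤ 2) (hintβ : ∀ i, Integrable (fun ω => |X i ω - μ| ^ (2 * β)) P)
    (hm : ∀ i, ∫ ω, |X i ω - μ| ^ (2 * β) ∂P = m) {ψ : ℝ → ℝ} (hψ : IsCatoniType β ψ)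
    {A p r T : ℝ} (hA : 0 ≤ A) (hp : |p| ≤ 5) (hr : |r| ≤ 5) :
    P.real {ω | Fintype.card ι * (A * (p + r) + 50 * (m / σ ^ (2 * β) + 1) * A ^ β) + T ≤
      ∑ i, ψ (A * (p * ((X i ω - μ) / σ) ^ 2 + r))} ≤ Real.exp (-T) := by
  have hpt : ∀ x : ℝ, |A * (p * ((x - μ) / σ) ^ 2 + r)| ^ β / β ≤
      50 * A ^ β * (|x - μ| ^ (2 * β) / σ ^ (2 * β) + 1) := by
    intro x
    set z := ((x - μ) / σ) ^ 2 with hz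
    have hz0 : 0 ≤ z := sq_nonneg _
    have hzβ : z ^ β = |x - μ| ^ (2 * β) / σ ^ (2 * β) := by
      rw [hz, ← sq_abs, abs_div, abs_of_pos hσ, ← Real.rpow_two, ← Real.rpow_mul (by positivity),
        Real.div_rpow (abs_nonneg _) hσ.le]
    have h1 : |A * (p * z + r)| ≤ A * (5 * (z + 1)) := by
      rw [abs_mul, abs_of_nonneg hA]
      refine mul_le_mul_of_nonneg_left ?_ hA
      calc |p * z + r| ≤ |p| * z + |r| := by
            refine (abs_add_le _ _).trans ?_
            rw [abs_mul, abs_of_nonneg hz0]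
        _ ≤ 5 * (z + 1) := by nlinarith
    have h5 : (5 : ℝ) ^ β ≤ 25 := by
      calc (5 : ℝ) ^ β ≤ 5 ^ (2 : ℝ) := Real.rpow_le_rpow_of_exponent_le (by norm_num) hβ'
        _ = 25 := by norm_num
    have h2 : (2 : ℝ) ^ (β - 1) ≤ 2 := by
      calc (2 : ℝ) ^ (β - 1) ≤ 2 ^ (1 : ℝ) :=
            Real.rpow_le_rpow_of_exponent_le (by norm_num) (by linarith)
        _ = 2 := by norm_num
    have h3 : (z + 1) ^ β ≤ 2 * (z ^ β + 1) := by
      have := NNReal.coe_le_coe.2 (NNReal.rpow_add_le_mul_rpow_add_rpow ⟨z, hz0⟩ 1 hβ)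
      push_cast [NNReal.one_rpow, NNReal.coe_mk] at this
      exact this.trans (mul_le_mul_of_nonneg_right h2 (by positivity))
    calc |A * (p * z + r)| ^ β / β ≤ |A * (p * z + r)| ^ β :=
          div_le_self (by positivity) hβ
      _ ≤ (A * (5 * (z + 1))) ^ β := Real.rpow_le_rpow (abs_nonneg _) h1 (by linarith)
      _ = A ^ β * (5 ^ β * (z + 1) ^ β) := by
          rw [Real.mul_rpow hA (by positivity), Real.mul_rpow (by norm_num) (by positivity)]
      _ ≤ A ^ β * (25 * (2 * (z ^ β + 1))) := by gcongr
      _ = 50 * A ^ β * (|x - μ| ^ (2 * β) / σ ^ (2 * β) + 1) := by rw [hzβ]; ring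
  have i1 : ∀ i, Integrable (fun ω => A * (p * ((X i ω - μ) / σ) ^ 2 + r)) P := fun i => by
    have := ((((hint2 i).div_const (σ ^ 2)).const_mul p).add (integrable_const r)).const_mul A
    simpa only [div_pow, Pi.add_apply] using this
  have i2 : ∀ i, Integrable
      (fun ω => 50 * A ^ β * (|X i ω - μ| ^ (2 * β) / σ ^ (2 * β) + 1)) P := fun i =>
    (((hintβ i).div_const _).add (integrable_const 1)).const_mul _
  have i3 : ∀ i, Integrable (fun ω => 1 + A * (p * ((X i ω - μ) / σ) ^ 2 + r)) P := fun i =>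
    (integrable_const 1).add (i1 i)
  have e1 : ∀ i, ∫ ω, A * (p * ((X i ω - μ) / σ) ^ 2 + r) ∂P = A * (p + r) := fun i => by
    have j : Integrable (fun ω => p * ((X i ω - μ) / σ) ^ 2) P := by
      simpa only [div_pow] using ((hint2 i).div_const (σ ^ 2)).const_mul p
    rw [integral_const_mul, integral_add j (integrable_const r), integral_const_mul]
    simp only [div_pow]
    rw [integral_div, hvar i]
    simp [hσ.ne']
  have e2 : ∀ i, ∫ ω, 50 * A ^ β * (|X i ω - μ| ^ (2 * β) / σ ^ (2 * β) + 1) ∂P =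
      50 * (m / σ ^ (2 * β) + 1) * A ^ β := fun i => by
    rw [integral_const_mul, integral_add ((hintβ i).div_const _) (integrable_const 1),
      integral_div, hm i]
    simp only [integral_const, probReal_univ, smul_eq_mul, mul_one]
    ring
  refine measureReal_le_exp_of_exp_le hX hind
    (g := fun x => ψ (A * (p * ((x - μ) / σ) ^ 2 + r)))
    (h := fun x => 1 + A * (p * ((x - μ) / σ) ^ 2 + r) +
      50 * A ^ β * (|x - μ| ^ (2 * β) / σ ^ (2 * β) + 1))
    (hψ.continuous.measurable.comp (by fun_prop))
    (fun x => (hψ.exp_le hβ _).trans (by linarith [hpt x]))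
    (fun i => (i3 i).add (i2 i)) fun i => ?_
  rw [integral_add (i3 i) (i2 i), e2,
    integral_add (integrable_const 1) (i1 i), e1]
  simp only [integral_const, probReal_univ, smul_eq_mul, mul_one]
  linarith

/-- Since `2|zd| ≤ D(z² + 1)` for `|d| ≤ D`, one has `(z - d)² ≤ (1 + D)(z² + D)`. Monotonicity of
`ψ` then bounds the sums for all admissible `θ` by a single one. -/
theorem measureReal_exists_quadratic_sum_pos_le (hX : ∀ i, Measurable (X i))
    (hind : iIndepFun X P) (hint2 : ∀ i, Integrable (fun ω => (X i ω - μ) ^ 2) P)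
    (hvar : ∀ i, ∫ ω, (X i ω - μ) ^ 2 ∂P = σ ^ 2) (hσ : 0 < σ) {β m : ℝ} (hβ : 1 ≤ β)
    (hβ' : β ≤ 2) (hintβ : ∀ i, Integrable (fun ω => |X i ω - μ| ^ (2 * β)) P)
    (hm : ∀ i, ∫ ω, |X i ω - μ| ^ (2 * β) ∂P = m) {ψ : ℝ → ℝ} (hψ : IsCatoniType β ψ)
    {A D v T : ℝ} (hA : 0 ≤ A) (hD0 : 0 ≤ D) (hD : D ≤ 1 / 2) (hs : σ ^ 2 / v ^ 2 ≤ 2)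
    (hneg : Fintype.card ι * (A * ((1 + D) ^ 2 * (σ ^ 2 / v ^ 2) - 1) +
      50 * (m / σ ^ (2 * β) + 1) * A ^ β) + T ≤ 0) :
    P.real {ω | ∃ θ, |θ - μ| ≤ σ * D ∧ 0 < ∑ i, ψ (A * ((X i ω - θ) ^ 2 / v ^ 2 - 1))} ≤
      Real.exp (-T) := by
  set s := σ ^ 2 / v ^ 2 with hs_def
  have hs0 : 0 ≤ s := by positivity
  have hDs : D * s ≤ 1 := by nlinarith
  have hDs0 : 0 ≤ D * s := by positivity
  have hDDs : D * (D * s) ≤ 1 / 2 := by nlinarith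
  have hDDs0 : 0 ≤ D * (D * s) := by positivity
  refine le_trans (measureReal_mono ?_) (measureReal_quadratic_le hX hind hint2 hvar hσ hβ hβ'
    hintβ hm hψ (p := (1 + D) * s) (r := (1 + D) * D * s - 1) hA
    (abs_le.2 ⟨by linarith, by linarith⟩) (abs_le.2 ⟨by linarith, by linarith⟩))
  rintro ω ⟨θ, hθ, hpos⟩
  have e : (1 + D) * s + ((1 + D) * D * s - 1) = (1 + D) ^ 2 * s - 1 := by ring
  rw [Set.mem_ofPred_eq, e]
  refine hneg.trans (hpos.le.trans (Finset.sum_le_sum fun i _ => hψ.monotone ?_))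
  refine mul_le_mul_of_nonneg_left ?_ hA
  obtain ⟨d, rfl⟩ : ∃ d, θ = μ + σ * d := ⟨(θ - μ) / σ, by field_simp; ring⟩
  have hd : |d| ≤ D := by
    rw [add_sub_cancel_left, abs_mul, abs_of_pos hσ] at hθ
    exact le_of_mul_le_mul_left hθ hσ
  set z := (X i ω - μ) / σ with hz
  have hx : (X i ω - (μ + σ * d)) ^ 2 / v ^ 2 = (z - d) ^ 2 * s := by
    rw [hz, hs_def]; field_simp; ring
  have hzd : (z - d) ^ 2 ≤ (1 + D) * (z ^ 2 + D) := by
    obtain ⟨hd1, hd2⟩ := abs_le.1 hd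
    nlinarith [mul_nonneg (sub_nonneg.2 hd2) (sq_nonneg (z - 1)),
      mul_nonneg (neg_le_iff_add_nonneg.1 hd1) (sq_nonneg (z + 1)),
      mul_nonneg (sub_nonneg.2 hd2) (sq_nonneg (z + 1)),
      mul_nonneg (neg_le_iff_add_nonneg.1 hd1) (sq_nonneg (z - 1))]
  rw [hx]
  linarith [mul_le_mul_of_nonneg_right hzd hs0]

/-- The same device with the lower envelope `(1 - D)z² - D ≤ (z - d)²`, applied to the reflected
influence function. -/
theorem measureReal_exists_quadratic_sum_neg_le (hX : ∀ i, Measurable (X i))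
    (hind : iIndepFun X P) (hint2 : ∀ i, Integrable (fun ω => (X i ω - μ) ^ 2) P)
    (hvar : ∀ i, ∫ ω, (X i ω - μ) ^ 2 ∂P = σ ^ 2) (hσ : 0 < σ) {β m : ℝ} (hβ : 1 ≤ β)
    (hβ' : β ≤ 2) (hintβ : ∀ i, Integrable (fun ω => |X i ω - μ| ^ (2 * β)) P)
    (hm : ∀ i, ∫ ω, |X i ω - μ| ^ (2 * β) ∂P = m) {ψ : ℝ → ℝ} (hψ : IsCatoniType β ψ)
    {A D v T : ℝ} (hA : 0 ≤ A) (hD0 : 0 ≤ D) (hD : D ≤ 1 / 2) (hs : σ ^ 2 / v ^ 2 ≤ 2)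
    (hneg : Fintype.card ι * (A * (1 - (1 - 2 * D) * (σ ^ 2 / v ^ 2)) +
      50 * (m / σ ^ (2 * β) + 1) * A ^ β) + T ≤ 0) :
    P.real {ω | ∃ θ, |θ - μ| ≤ σ * D ∧ ∑ i, ψ (A * ((X i ω - θ) ^ 2 / v ^ 2 - 1)) < 0} ≤
      Real.exp (-T) := by
  set s := σ ^ 2 / v ^ 2 with hs_def
  have hs0 : 0 ≤ s := by positivity
  have hDs : D * s ≤ 1 := by nlinarith
  have hDs0 : 0 ≤ D * s := by positivity
  refine le_trans (measureReal_mono ?_) (measureReal_quadratic_le hX hind hint2 hvar hσ hβ hβ'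
    hintβ hm hψ.reflect (p := -((1 - D) * s)) (r := D * s + 1) hA
    (abs_le.2 ⟨by linarith, by linarith⟩) (abs_le.2 ⟨by linarith, by linarith⟩))
  rintro ω ⟨θ, hθ, hlt⟩
  have e : -((1 - D) * s) + (D * s + 1) = 1 - (1 - 2 * D) * s := by ring
  rw [Set.mem_ofPred_eq, e]
  refine hneg.trans ?_
  rw [Finset.sum_neg_distrib, Left.nonneg_neg_iff]
  refine (Finset.sum_le_sum fun i _ => hψ.monotone ?_).trans hlt.le
  rw [← mul_neg]
  refine mul_le_mul_of_nonneg_left ?_ hA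
  obtain ⟨d, rfl⟩ : ∃ d, θ = μ + σ * d := ⟨(θ - μ) / σ, by field_simp; ring⟩
  have hd : |d| ≤ D := by
    rw [add_sub_cancel_left, abs_mul, abs_of_pos hσ] at hθ
    exact le_of_mul_le_mul_left hθ hσ
  set z := (X i ω - μ) / σ with hz
  have hx : (X i ω - (μ + σ * d)) ^ 2 / v ^ 2 = (z - d) ^ 2 * s := by
    rw [hz, hs_def]; field_simp; ring
  have hzd : (1 - D) * z ^ 2 - D ≤ (z - d) ^ 2 := by
    obtain ⟨hd1, hd2⟩ := abs_le.1 hd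
    nlinarith [mul_nonneg (sub_nonneg.2 hd2) (sq_nonneg (z - 1)),
      mul_nonneg (neg_le_iff_add_nonneg.1 hd1) (sq_nonneg (z + 1)),
      mul_nonneg (sub_nonneg.2 hd2) (sq_nonneg (z + 1)),
      mul_nonneg (neg_le_iff_add_nonneg.1 hd1) (sq_nonneg (z - 1)), sq_nonneg d]
  rw [hx]
  linarith [mul_le_mul_of_nonneg_right hzd hs0]

end Concentration

/-! ### Measurable solutions of the coupled equations -/

section Selection

variable {n : ℕ} {ψ₁ ψ₂ : ℝ → ℝ} {β ε a b c d : ℝ}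

theorem continuousOn_catoniF₁ {α : Type*} [TopologicalSpace α] {S : Set α} (hψ₁ : Continuous ψ₁)
    {x : α → Fin n → ℝ} {θ v : α → ℝ} (hx : ContinuousOn x S) (hθ : ContinuousOn θ S)
    (hv : ContinuousOn v S) (h0 : ∀ p ∈ S, v p ≠ 0) :
    ContinuousOn (fun p => catoniF₁ ψ₁ β ε (x p) (θ p) (v p)) S := by
  unfold catoniF₁
  refine continuousOn_const.mul (continuousOn_finsetSum _ fun i _ => ?_)
  refine hψ₁.comp_continuousOn (continuousOn_const.mul ?_)
  exact (((continuous_apply i).comp_continuousOn hx).sub hθ).div hv h0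

theorem continuousOn_catoniF₂ {α : Type*} [TopologicalSpace α] {S : Set α} (hψ₂ : Continuous ψ₂)
    {x : α → Fin n → ℝ} {θ v : α → ℝ} (hx : ContinuousOn x S) (hθ : ContinuousOn θ S)
    (hv : ContinuousOn v S) (h0 : ∀ p ∈ S, v p ≠ 0) :
    ContinuousOn (fun p => catoniF₂ ψ₂ β ε (x p) (θ p) (v p)) S := by
  unfold catoniF₂
  refine continuousOn_const.mul (continuousOn_finsetSum _ fun i _ => ?_)
  refine hψ₂.comp_continuousOn (continuousOn_const.mul (ContinuousOn.sub ?_ continuousOn_const))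
  exact ((((continuous_apply i).comp_continuousOn hx).sub hθ).pow 2).div (hv.pow 2)
    fun p hp => pow_ne_zero 2 (h0 p hp)

theorem antitone_catoniF₁ (hψ₁ : Monotone ψ₁) (x : Fin n → ℝ) {v : ℝ} (hv : 0 < v) :
    Antitone fun θ => catoniF₁ ψ₁ β ε x θ v := by
  intro s t hst
  have hα : 0 ≤ catoniAlpha₁ n β ε := Real.sqrt_nonneg _
  unfold catoniF₁
  refine mul_le_mul_of_nonneg_left (Finset.sum_le_sum fun i _ => hψ₁ ?_) (by positivity)
  gcongr

/-- On the samples for which the two Catoni functions change sign across the rectangle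
`[a, b] × [c, d]`, a solution in this rectangle can be selected measurably. -/
theorem exists_measurable_jointCatoniSolution (hψ₁ : Continuous ψ₁) (hψ₁' : Monotone ψ₁)
    (hψ₂ : Continuous ψ₂) (hab : a ≤ b) (hc : 0 < c) (hcd : c ≤ d) :
    ∃ θhat vhat : (Fin n → ℝ) → ℝ, Measurable θhat ∧ Measurable vhat ∧
      ∀ x : Fin n → ℝ,
        (∀ v ∈ Set.Icc c d, 0 ≤ catoniF₁ ψ₁ β ε x a v) →
        (∀ v ∈ Set.Icc c d, catoniF₁ ψ₁ β ε x b v ≤ 0) →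
        (∀ θ ∈ Set.Icc a b, 0 ≤ catoniF₂ ψ₂ β ε x θ c) →
        (∀ θ ∈ Set.Icc a b, catoniF₂ ψ₂ β ε x θ d ≤ 0) →
        θhat x ∈ Set.Icc a b ∧ vhat x ∈ Set.Icc c d ∧
          IsJointCatoniSolution ψ₁ ψ₂ β ε x (θhat x) (vhat x) := by
  set R : Set (((Fin n → ℝ) × ℝ) × ℝ) := {p | p.1.2 ∈ Set.Icc a b ∧ p.2 ∈ Set.Icc c d} with hR
  have hRc : IsClosed R :=
    (isClosed_Icc.preimage (by fun_prop : Continuous fun p : ((Fin n → ℝ) × ℝ) × ℝ => p.1.2)).inter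
      (isClosed_Icc.preimage continuous_snd)
  have hR0 : ∀ p ∈ R, p.2 ≠ 0 := fun p hp => (hc.trans_le hp.2.1).ne'
  have hF : ContinuousOn (fun p : ((Fin n → ℝ) × ℝ) × ℝ =>
      (catoniF₁ ψ₁ β ε p.1.1 p.1.2 p.2, catoniF₂ ψ₂ β ε p.1.1 p.1.2 p.2)) R :=
    (continuousOn_catoniF₁ hψ₁ (by fun_prop) (by fun_prop) (by fun_prop) hR0).prodMk
      (continuousOn_catoniF₂ hψ₂ (by fun_prop) (by fun_prop) (by fun_prop) hR0)
  -- The solution set inside the rectangle is closed because `v ≥ c > 0` keeps both functions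
  -- continuous.
  obtain ⟨θhat, vhat, hθ, hv, hsel⟩ := exists_measurable_selection_prod
    (hF.preimage_isClosed_of_isClosed hRc (isClosed_singleton (x := ((0 : ℝ), (0 : ℝ)))))
    (fun p hp => hp.1)
  refine ⟨θhat, vhat, hθ, hv, fun x h1 h2 h3 h4 => ?_⟩
  obtain ⟨s, hs, t, ht, e1, e2⟩ := exists_common_zero_of_antitoneOn hab hcd
    (F := fun p => catoniF₁ ψ₁ β ε x p.1 p.2) (G := fun p => catoniF₂ ψ₂ β ε x p.1 p.2)
    (continuousOn_catoniF₁ hψ₁ (by fun_prop) (by fun_prop) (by fun_prop)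
      fun p hp => (hc.trans_le hp.2.1).ne')
    (continuousOn_catoniF₂ hψ₂ (by fun_prop) (by fun_prop) (by fun_prop)
      fun p hp => (hc.trans_le hp.2.1).ne')
    (fun v hv => (antitone_catoniF₁ hψ₁' x (hc.trans_le hv.1)).antitoneOn _) h1 h2 h3 h4
  obtain ⟨⟨hθx, hvx⟩, hz⟩ := hsel x ⟨s, t, ⟨hs, ht⟩, Prod.ext e1 e2⟩
  have hz' := Prod.ext_iff.1 (Set.mem_singleton_iff.1 hz)
  exact ⟨hθx, hvx, hc.trans_le hvx.1, hz'.1, hz'.2⟩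

end Selection

/-! ### Comparison of the scales -/

section Scales

variable {n : ℕ} {β ε : ℝ}

theorem log_rpow_mul_inv (hn : 0 < n) (ρ : ℝ) (hε : 0 < ε) :
    Real.log ((n : ℝ) ^ ρ * ε⁻¹) = ρ * Real.log n + Real.log ε⁻¹ := by
  have hn' : (0 : ℝ) < n := by exact_mod_cast hn
  rw [Real.log_mul (Real.rpow_pos_of_pos hn' _).ne' (inv_pos.2 hε).ne', Real.log_rpow hn']

theorem catoniAlpha₁_sq (hn : 0 < n) (hβ : 1 < β) (hβ' : β ≤ 2) (hε : 0 < ε)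
    (hL : 1 ≤ Real.log ε⁻¹) :
    catoniAlpha₁ n β ε ^ 2 = ((1 / β - 1 / 2) * Real.log n + Real.log ε⁻¹) / n := by
  have hn' : (1 : ℝ) ≤ n := by exact_mod_cast hn
  have hρ : 0 ≤ 1 / β - 1 / 2 := by
    rw [sub_nonneg]; exact one_div_le_one_div_of_le (by linarith) hβ'
  have := Real.log_nonneg hn'
  rw [catoniAlpha₁, log_rpow_mul_inv hn _ hε, Real.sq_sqrt (by positivity)]

theorem log_inv_le_mul_catoniAlpha₁_sq (hn : 0 < n) (hβ : 1 < β) (hβ' : β ≤ 2) (hε : 0 < ε)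
    (hL : 1 ≤ Real.log ε⁻¹) : Real.log ε⁻¹ ≤ n * catoniAlpha₁ n β ε ^ 2 := by
  have hn' : (1 : ℝ) ≤ n := by exact_mod_cast hn
  have hρ : 0 ≤ 1 / β - 1 / 2 := by
    rw [sub_nonneg]; exact one_div_le_one_div_of_le (by linarith) hβ'
  rw [catoniAlpha₁_sq hn hβ hβ' hε hL, mul_div_cancel₀ _ (by linarith)]
  linarith [mul_nonneg hρ (Real.log_nonneg hn')]

/-- Put `ρ = 1/β - 1/2` and `L = log ε⁻¹`, so that `k² = (L/n)^(1-2ρ)`. For `ρ > 0`, `log n ≤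
n^(2ρ)/(2ρ)` and `L ≥ 1` give `ρ log n / n ≤ k²/2`; for `ρ = 0` this is trivial. Together with `L/n
≤ k²` the total is `3/2 ≤ (5/4)²` times `k²`. -/
theorem catoniAlpha₁_le (hn : 0 < n) (hβ : 1 < β) (hβ' : β ≤ 2) (hε : 0 < ε)
    (hL : 1 ≤ Real.log ε⁻¹) (hLn : Real.log ε⁻¹ ≤ n) :
    catoniAlpha₁ n β ε ≤ 5 / 4 * (Real.log ε⁻¹ / n) ^ ((β - 1) / β) := by
  have hn' : (1 : ℝ) ≤ n := by exact_mod_cast hn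
  have hn0 : (0 : ℝ) < n := by linarith
  set L := Real.log ε⁻¹
  have hq0 : 0 < L / n := by positivity
  have hq1 : L / n ≤ 1 := by rw [div_le_one hn0]; exact hLn
  have hρ : 0 ≤ 1 / β - 1 / 2 := by
    rw [sub_nonneg]; exact one_div_le_one_div_of_le (by linarith) hβ'
  have hγ : (β - 1) / β = 1 / 2 - (1 / β - 1 / 2) := by field_simp; ring
  generalize hρ_def : 1 / β - 1 / 2 = ρ at *
  have hρ2 : ρ ≤ 1 / 2 := by
    have : 0 ≤ (β - 1) / β := div_nonneg (by linarith) (by linarith)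
    linarith
  have hk : ((L / n) ^ ((β - 1) / β)) ^ 2 = (L / n) ^ (1 - 2 * ρ) := by
    rw [← Real.rpow_natCast, ← Real.rpow_mul hq0.le, hγ]; congr 1; push_cast; ring
  refine le_of_sq_le_sq ?_ (by positivity)
  rw [catoniAlpha₁_sq hn hβ hβ' hε hL, mul_pow, hk, hρ_def, add_div]
  have h1 : L / n ≤ (L / n) ^ (1 - 2 * ρ) := by
    conv_lhs => rw [← Real.rpow_one (L / n)]
    exact Real.rpow_le_rpow_of_exponent_ge hq0 hq1 (by linarith)
  have h2 : ρ * Real.log n ≤ 1 / 2 * (n : ℝ) ^ (2 * ρ) := by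
    rcases hρ.eq_or_lt with h | h
    · rw [← h]; simp
    · have := Real.log_le_rpow_div hn0.le (by linarith : 0 < 2 * ρ)
      have h3 := mul_le_mul_of_nonneg_left this hρ
      have e : ρ * ((n : ℝ) ^ (2 * ρ) / (2 * ρ)) = 1 / 2 * (n : ℝ) ^ (2 * ρ) := by
        field_simp
      linarith
  have h3 : ρ * Real.log n / n ≤ 1 / 2 * (L / n) ^ (1 - 2 * ρ) := by
    calc ρ * Real.log n / n ≤ 1 / 2 * (n : ℝ) ^ (2 * ρ) / n := by gcongr
      _ = 1 / 2 * (1 / n) ^ (1 - 2 * ρ) := by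
          rw [Real.div_rpow zero_le_one hn0.le, Real.one_rpow, Real.rpow_sub hn0, Real.rpow_one]
          field_simp
      _ ≤ 1 / 2 * (L / n) ^ (1 - 2 * ρ) := by
          gcongr
          linarith
  linarith

end Scales

/-! ### Integrability of lower moments -/

theorem sq_le_one_add_rpow {β : ℝ} (hβ : 1 ≤ β) (x : ℝ) : x ^ 2 ≤ 1 + |x| ^ (2 * β) := by
  have h := one_add_mul_self_le_rpow_one_add (s := x ^ 2 - 1) (by linarith [sq_nonneg x]) hβ
  rw [add_sub_cancel, ← sq_abs, ← Real.rpow_two, ← Real.rpow_mul (abs_nonneg x)] at h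
  have h2 : |x| ^ (2 : ℝ) = x ^ 2 := by rw [Real.rpow_two, sq_abs]
  have h3 : 0 ≤ |x| ^ (2 * β) := by positivity
  rw [h2] at h
  rcases le_total (x ^ 2) 1 with h1 | h1
  · linarith
  · nlinarith [mul_nonneg (sub_nonneg.2 hβ) (sub_nonneg.2 h1)]

theorem integrable_sq_of_integrable_rpow {Ω : Type*} [MeasurableSpace Ω] {P : Measure Ω}
    [IsFiniteMeasure P] {Y : Ω → ℝ} (hY : Measurable Y) {β : ℝ} (hβ : 1 ≤ β)
    (h : Integrable (fun ω => |Y ω| ^ (2 * β)) P) : Integrable (fun ω => Y ω ^ 2) P :=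
  ((integrable_const 1).add h).mono' (by fun_prop) (ae_of_all _ fun ω => by
    rw [Real.norm_eq_abs, abs_of_nonneg (sq_nonneg _)]
    exact sq_le_one_add_rpow hβ _)

theorem integrable_of_integrable_sq_sub {Ω : Type*} [MeasurableSpace Ω] {P : Measure Ω}
    [IsFiniteMeasure P] {Y : Ω → ℝ} (hY : Measurable Y) {μ : ℝ}
    (h : Integrable (fun ω => (Y ω - μ) ^ 2) P) : Integrable Y P := by
  have h1 : Integrable (fun ω => Y ω - μ) P :=
    ((integrable_const 1).add h).mono' (by fun_prop) (ae_of_all _ fun ω => by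
      rw [Real.norm_eq_abs]
      change |Y ω - μ| ≤ 1 + (Y ω - μ) ^ 2
      exact abs_le.2 ⟨by nlinarith [sq_nonneg (Y ω - μ + 1)],
        by nlinarith [sq_nonneg (Y ω - μ - 1)]⟩)
  have h2 : Integrable (fun ω => Y ω - μ + μ) P := h1.add (integrable_const μ)
  simpa using h2

/-! ### Sign pattern and conclusion -/

/-- On a rectangle centred at the true parameters, the two estimating functions have the sign
pattern that forces a joint solution, outside an event of probability at most `4 ε`. -/
theorem measureReal_not_sign_pattern_le {Ω : Type*} [MeasurableSpace Ω] {P : Measure Ω}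
    [IsProbabilityMeasure P] {n : ℕ} {X : Fin n → Ω → ℝ} {μ σ β m ε κ c d : ℝ}
    {ψ₁ ψ₂ : ℝ → ℝ} (hX : ∀ i, Measurable (X i)) (hind : iIndepFun X P)
    (hmean : ∀ i, ∫ ω, X i ω ∂P = μ) (hvar : ∀ i, ∫ ω, (X i ω - μ) ^ 2 ∂P = σ ^ 2)
    (hintβ : ∀ i, Integrable (fun ω => |X i ω - μ| ^ (2 * β)) P)
    (hm : ∀ i, ∫ ω, |X i ω - μ| ^ (2 * β) ∂P = m)
    (hψ₁ : IsCatoniType 2 ψ₁) (hψ₂ : IsCatoniType β ψ₂)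
    (hβ : 1 < β) (hβ' : β ≤ 2) (hσ : 0 < σ) (hε : 0 < ε) (hε' : ε < 1 / 4) (hn : 0 < n)
    (hL : 1 ≤ Real.log ε⁻¹) (hα : catoniAlpha₁ n β ε ≤ 1 / 100) (hκ0 : 0 ≤ κ)
    (hκ : κ ≤ 1 / 100) (hc0 : 0 < c) (hcd : c ≤ d) (hc : σ ^ 2 / c ^ 2 = 1 + κ)
    (hd : σ ^ 2 / d ^ 2 = 1 - κ)
    (hthr : catoniAlpha₂ n β ε * (24 * catoniAlpha₁ n β ε - κ) +
      50 * (m / σ ^ (2 * β) + 1) * catoniAlpha₂ n β ε ^ β + 2 * (Real.log ε⁻¹ / n) ≤ 0) :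
    P.real {ω | ¬ ((∀ v ∈ Set.Icc c d, 0 ≤ catoniF₁ ψ₁ β ε (fun i => X i ω)
          (μ - 6 * σ * catoniAlpha₁ n β ε) v) ∧
        (∀ v ∈ Set.Icc c d, catoniF₁ ψ₁ β ε (fun i => X i ω)
          (μ + 6 * σ * catoniAlpha₁ n β ε) v ≤ 0) ∧
        (∀ θ ∈ Set.Icc (μ - 6 * σ * catoniAlpha₁ n β ε) (μ + 6 * σ * catoniAlpha₁ n β ε),
          0 ≤ catoniF₂ ψ₂ β ε (fun i => X i ω) θ c) ∧
        (∀ θ ∈ Set.Icc (μ - 6 * σ * catoniAlpha₁ n β ε) (μ + 6 * σ * catoniAlpha₁ n β ε),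
          catoniF₂ ψ₂ β ε (fun i => X i ω) θ d ≤ 0))} ≤ 4 * ε := by
  have hn0 : (0 : ℝ) < n := by exact_mod_cast hn
  have hα0 : 0 ≤ catoniAlpha₁ n β ε := Real.sqrt_nonneg _
  have hA0 : 0 ≤ catoniAlpha₂ n β ε := by unfold catoniAlpha₂; positivity
  have hLα := log_inv_le_mul_catoniAlpha₁_sq hn hβ hβ' hε hL
  have hint2 : ∀ i, Integrable (fun ω => (X i ω - μ) ^ 2) P := fun i =>
    integrable_sq_of_integrable_rpow ((hX i).sub_const μ) hβ.le (hintβ i)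
  have hint : ∀ i, Integrable (X i) P := fun i =>
    integrable_of_integrable_sq_sub (hX i) (hint2 i)
  have hexp : Real.exp (-(2 * Real.log ε⁻¹)) = ε ^ 2 := by
    rw [Real.log_inv, mul_neg, neg_neg, two_mul, Real.exp_add, Real.exp_log hε, sq]
  -- Normalising by `σ` isolates the dependence on `v` in the scalar `τ = σ/v`.
  have hF₁ : ∀ (x : Fin n → ℝ) (θ v : ℝ), 0 < v → catoniF₁ ψ₁ β ε x θ v =
      1 / n * ∑ i, ψ₁ (catoniAlpha₁ n β ε * ((x i - θ) / σ) * (σ / v)) := by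
    intro x θ v hv
    unfold catoniF₁
    congr! 3 with i
    field_simp
  unfold catoniF₂
  generalize catoniAlpha₁ n β ε = α at *
  generalize catoniAlpha₂ n β ε = A at *
  generalize Real.log ε⁻¹ = L at *
  have hd0 : 0 < d := hc0.trans_le hcd
  have hab : σ / d ≤ σ / c := by gcongr
  have ha : 9 / 10 ≤ σ / d := by
    refine le_of_sq_le_sq ?_ (by positivity)
    rw [div_pow σ, hd]; linarith
  have hb : σ / c ≤ 11 / 10 := by
    refine le_of_sq_le_sq ?_ (by positivity)
    rw [div_pow σ, hc]; linarith
  have hba : σ / c - σ / d ≤ 1 / 40 := by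
    have h1 : (σ / c) ^ 2 - (σ / d) ^ 2 = 2 * κ := by
      rw [div_pow, div_pow, hc, hd]; ring
    nlinarith
  have hT1 : Real.exp (-(2 * (n : ℝ) * α ^ 2)) ≤ ε ^ 2 := by
    rw [← hexp]; exact Real.exp_le_exp.2 (by linarith)
  have h1 := measureReal_exists_sum_pos_le hX hind hint hint2 hmean hvar hσ hψ₁ hα0
    (by linarith) ha hab hb hba
  have h2 := measureReal_exists_sum_neg_le hX hind hint hint2 hmean hvar hσ hψ₁ hα0
    (by linarith) ha hab hb hba
  have hbase : n * (A * (24 * α - κ) + 50 * (m / σ ^ (2 * β) + 1) * A ^ β) + 2 * L ≤ 0 := by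
    have := mul_le_mul_of_nonneg_left hthr hn0.le
    have e : (n : ℝ) * (A * (24 * α - κ) + 50 * (m / σ ^ (2 * β) + 1) * A ^ β + 2 * (L / n)) =
        n * (A * (24 * α - κ) + 50 * (m / σ ^ (2 * β) + 1) * A ^ β) + 2 * L := by
      field_simp
    linarith
  have hακ : α * κ ≤ α := mul_le_of_le_one_right hα0 (by linarith)
  have hακ0 : 0 ≤ α * κ := mul_nonneg hα0 hκ0
  have hαα : α * α ≤ 1 / 100 * α := mul_le_mul_of_nonneg_right hα hα0
  -- The `24α` in `hthr` serves both horizontal sides: `12α` is the first-order effect of moving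
  -- `θ`, and the other `12α` absorbs the terms in `α²` and `ακ`.
  have h3 := measureReal_exists_quadratic_sum_pos_le hX hind hint2 hvar hσ hβ.le hβ' hintβ hm
    hψ₂ (A := A) (D := 6 * α) (v := d) (T := 2 * L) hA0 (by linarith) (by linarith)
    (by rw [hd]; linarith) (by
      refine le_trans ?_ hbase
      rw [hd, Fintype.card_fin]
      have h0 : 0 ≤ α * α * κ := by positivity
      have e : (1 + 6 * α) ^ 2 * (1 - κ) - 1 ≤ 24 * α - κ := by linarith
      linarith [mul_le_mul_of_nonneg_left (mul_le_mul_of_nonneg_left e hA0) hn0.le])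
  have h4 := measureReal_exists_quadratic_sum_neg_le hX hind hint2 hvar hσ hβ.le hβ' hintβ hm
    hψ₂ (A := A) (D := 6 * α) (v := c) (T := 2 * L) hA0 (by linarith) (by linarith)
    (by rw [hc]; linarith) (by
      refine le_trans ?_ hbase
      rw [hc, Fintype.card_fin]
      have e : 1 - (1 - 2 * (6 * α)) * (1 + κ) ≤ 24 * α - κ := by linarith
      linarith [mul_le_mul_of_nonneg_left (mul_le_mul_of_nonneg_left e hA0) hn0.le])
  rw [Fintype.card_fin] at h1 h2
  rw [hexp] at h3 h4
  have hτ : ∀ v ∈ Set.Icc c d, σ / v ∈ Set.Icc (σ / d) (σ / c) := fun v hv => by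
    have hv0 : 0 < v := hc0.trans_le hv.1
    exact ⟨by gcongr; exact hv.2, by gcongr; exact hv.1⟩
  have hθ : ∀ θ ∈ Set.Icc (μ - 6 * σ * α) (μ + 6 * σ * α), |θ - μ| ≤ σ * (6 * α) :=
    fun θ h => abs_le.2 ⟨by linarith [h.1], by linarith [h.2]⟩
  have hpos : 0 ≤ 1 / (n : ℝ) := by positivity
  -- Each vertical side costs `3ε²` and each horizontal side `ε²`; the total `8ε²` is at most `4ε`.
  refine (measureReal_mono (s₂ := (_ ∪ _) ∪ (_ ∪ _)) ?_ (measure_ne_top _ _)).trans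
    ((measureReal_union_le _ _).trans ((add_le_add ((measureReal_union_le _ _).trans
      (add_le_add h1 h2)) ((measureReal_union_le _ _).trans (add_le_add h3 h4))).trans ?_))
  · intro ω hω
    by_contra hcon
    simp only [Set.mem_union, Set.mem_ofPred_eq, not_or, not_exists, not_and, not_lt] at hcon
    obtain ⟨⟨k1, k2⟩, k3, k4⟩ := hcon
    refine hω ⟨fun v hv => ?_, fun v hv => ?_, fun θ h => ?_, fun θ h => ?_⟩
    · rw [hF₁ _ _ _ (hc0.trans_le hv.1)]
      exact mul_nonneg hpos (k2 _ (hτ v hv))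
    · rw [hF₁ _ _ _ (hc0.trans_le hv.1)]
      exact mul_nonpos_of_nonneg_of_nonpos hpos (k1 _ (hτ v hv))
    · exact mul_nonneg hpos (k4 _ (hθ θ h))
    · exact mul_nonpos_of_nonneg_of_nonpos hpos (k3 _ (hθ θ h))
  · nlinarith

theorem sq_div_rpow_neg_half_mul_sq {σ t : ℝ} (hσ : 0 < σ) (ht : 0 < t) :
    σ ^ 2 / (t ^ (-(1 / 2) : ℝ) * σ) ^ 2 = t := by
  have h : (t ^ (-(1 / 2) : ℝ)) ^ 2 = t⁻¹ := by
    rw [← Real.rpow_natCast, ← Real.rpow_mul ht.le, ← Real.rpow_neg_one]; norm_num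
  rw [mul_pow, h]
  field_simp

theorem theorem2p1 (β σ m : ℝ) (hβ : 1 < β) (hβ' : β ≤ 2) (hσ : 0 < σ) :
    ∃ C c₀ : ℝ, 0 < C ∧ 0 < c₀ ∧
      ∀ (ε : ℝ), 0 < ε → ε < 1 / 4 →
      ∀ (n : ℕ), C * (Real.log ε⁻¹ + 1) ≤ n →
        c₀ * (Real.log ε⁻¹ / n) ^ ((β - 1) / β) < 1 ∧
        ∀ (ψ₁ ψ₂ : ℝ → ℝ), IsCatoniType 2 ψ₁ → IsCatoniType β ψ₂ →
        ∀ (Ω : Type*) [MeasurableSpace Ω] (P : Measure Ω) [IsProbabilityMeasure P]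
          (μ : ℝ) (X : Fin n → Ω → ℝ),
          (∀ i, Measurable (X i)) →
          iIndepFun X P →
          (∀ i j, IdentDistrib (X i) (X j) P P) →
          (∀ i, ∫ ω, X i ω ∂P = μ) →
          (∀ i, ∫ ω, |X i ω - μ| ^ 2 ∂P = σ ^ 2) →
          (∀ i, Integrable (fun ω => |X i ω - μ| ^ (2 * β)) P) →
          (∀ i, ∫ ω, |X i ω - μ| ^ (2 * β) ∂P = m) →
          ∃ θhat vhat : (Fin n → ℝ) → ℝ, Measurable θhat ∧ Measurable vhat ∧
            1 - 4 * ε ≤ P.real {ω |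
              let x : Fin n → ℝ := fun i => X i ω
              IsJointCatoniSolution ψ₁ ψ₂ β ε x (θhat x) (vhat x) ∧
              |θhat x - μ| ≤
                6 * σ * Real.sqrt (Real.log ((n : ℝ) ^ (1 / β - 1 / 2) * ε⁻¹) / n) ∧
              (1 + c₀ * (Real.log ε⁻¹ / n) ^ ((β - 1) / β)) ^ (-(1 / 2) : ℝ) * σ ≤ vhat x ∧
              vhat x ≤
                (1 - c₀ * (Real.log ε⁻¹ / n) ^ ((β - 1) / β)) ^ (-(1 / 2) : ℝ) * σ} := by
  -- The first term beats the moment term; `40` covers the `24 · 5/4 = 30` due to `α₁` and the `2`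
  -- due to the deviation `2 log ε⁻¹`. The absolute value is needed because `m` is still an
  -- arbitrary real here.
  set c₀ : ℝ := 50 * (|m| / σ ^ (2 * β) + 1) + 40 with hc₀
  have hc₀1 : 90 ≤ c₀ := by
    have : 0 ≤ |m| / σ ^ (2 * β) := by positivity
    linarith
  have hexpo : 0 < (β - 1) / β := div_pos (by linarith) (by linarith)
  refine ⟨(100 * c₀) ^ (β / (β - 1)), c₀, by positivity, by linarith, fun ε hε hε' n hn => ?_⟩
  -- The exponent is inverse to that in `k`, so `n ≥ C log ε⁻¹` forces `k ≤ 1/(100 c₀)`, that is `κ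
  -- ≤ 1/100`.
  set C : ℝ := (100 * c₀) ^ (β / (β - 1)) with hC
  have hC1 : 1 ≤ C :=
    Real.one_le_rpow (by linarith) (div_nonneg (by linarith) (by linarith))
  have hL : 1 ≤ Real.log ε⁻¹ := by
    rw [Real.le_log_iff_exp_le (inv_pos.2 hε)]
    have : (4 : ℝ) ≤ ε⁻¹ := by
      rw [le_inv_comm₀ (by norm_num) hε]; linarith
    linarith [Real.exp_one_lt_d9]
  have hLn : Real.log ε⁻¹ ≤ n := by nlinarith
  have hn0 : (0 : ℝ) < n := by linarith
  have hnpos : 0 < n := by exact_mod_cast hn0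
  have hq : Real.log ε⁻¹ / n ≤ C⁻¹ := by
    rw [div_le_iff₀ hn0, ← div_eq_inv_mul, le_div_iff₀ (by linarith)]
    nlinarith
  have hq0 : 0 < Real.log ε⁻¹ / n := by positivity
  set k := (Real.log ε⁻¹ / n) ^ ((β - 1) / β) with hk
  have hk0 : 0 < k := by positivity
  have hCk : C⁻¹ ^ ((β - 1) / β) = (100 * c₀)⁻¹ := by
    rw [hC, ← Real.inv_rpow (by linarith), ← Real.rpow_mul (by positivity)]
    have : β / (β - 1) * ((β - 1) / β) = 1 := by
      have : β - 1 ≠ 0 := by linarith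
      field_simp
    rw [this, Real.rpow_one]
  have hk1 : k ≤ (100 * c₀)⁻¹ := by
    rw [← hCk]
    exact Real.rpow_le_rpow hq0.le hq hexpo.le
  have hκ : c₀ * k ≤ 1 / 100 := by
    rw [← one_div, le_div_iff₀ (by linarith)] at hk1
    linarith
  have hκ0 : 0 < c₀ * k := by positivity
  refine ⟨by linarith, ?_⟩
  intro ψ₁ ψ₂ hψ₁ hψ₂ Ω _ P _ μ X hX hind _ hmean hvar hintβ hm
  simp only [sq_abs] at hvar
  have hα := catoniAlpha₁_le hnpos hβ hβ' hε hL hLn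
  rw [← hk] at hα
  have hk9 : 90 * k ≤ c₀ * k := by gcongr
  have hα0 : 0 ≤ catoniAlpha₁ n β ε := Real.sqrt_nonneg _
  have hcd : (1 + c₀ * k) ^ (-(1 / 2) : ℝ) * σ ≤ (1 - c₀ * k) ^ (-(1 / 2) : ℝ) * σ :=
    mul_le_mul_of_nonneg_right (Real.rpow_le_rpow_of_nonpos (by linarith) (by linarith)
      (by norm_num)) hσ.le
  have hc0 : 0 < (1 + c₀ * k) ^ (-(1 / 2) : ℝ) * σ := by positivity
  have h6 : 0 ≤ 6 * σ * catoniAlpha₁ n β ε := by positivity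
  obtain ⟨θhat, vhat, hθ, hv, hsol⟩ := exists_measurable_jointCatoniSolution (n := n) (β := β)
    (ε := ε) (a := μ - 6 * σ * catoniAlpha₁ n β ε) (b := μ + 6 * σ * catoniAlpha₁ n β ε)
    hψ₁.continuous hψ₁.monotone hψ₂.continuous (by linarith) hc0 hcd
  refine ⟨θhat, vhat, hθ, hv, ?_⟩
  -- With this identity and the next, every term of the threshold condition is bounded by a multiple
  -- of `log ε⁻¹ / n`.
  have hA : catoniAlpha₂ n β ε * k = Real.log ε⁻¹ / n := by
    rw [catoniAlpha₂, hk, ← Real.rpow_add hq0]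
    have : 1 / β + (β - 1) / β = 1 := by field_simp; ring
    rw [this, Real.rpow_one]
  have hAβ : catoniAlpha₂ n β ε ^ β = Real.log ε⁻¹ / n := by
    rw [catoniAlpha₂, ← Real.rpow_mul hq0.le, one_div, inv_mul_cancel₀ (by linarith),
      Real.rpow_one]
  have hA0 : 0 ≤ catoniAlpha₂ n β ε := by unfold catoniAlpha₂; positivity
  have hbad := measureReal_not_sign_pattern_le hX hind hmean hvar hintβ hm hψ₁ hψ₂ hβ hβ' hσ hε
    hε' hnpos hL (by linarith) hκ0.le hκ hc0 hcd
    (sq_div_rpow_neg_half_mul_sq hσ (by linarith)) (sq_div_rpow_neg_half_mul_sq hσ (by linarith))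
    (by
      rw [hAβ]
      have hm' : m / σ ^ (2 * β) ≤ |m| / σ ^ (2 * β) := by
        gcongr
        exact le_abs_self m
      have h1 : catoniAlpha₂ n β ε * (24 * catoniAlpha₁ n β ε - c₀ * k) ≤
          (30 - c₀) * (Real.log ε⁻¹ / n) := by
        rw [← hA]
        have := mul_le_mul_of_nonneg_left hα hA0
        linarith
      have h2 := mul_le_mul_of_nonneg_right hm' hq0.le
      rw [hc₀] at h1
      linarith)
  set B := {ω | ¬ ((∀ v ∈ Set.Icc _ _, 0 ≤ catoniF₁ ψ₁ β ε (fun i => X i ω) _ v) ∧ _)}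
  have hcompl : 1 ≤ P.real Bᶜ + P.real B := by
    have := measureReal_union_le (μ := P) Bᶜ B
    rwa [Set.compl_union_self, probReal_univ] at this
  refine le_trans (by linarith : 1 - 4 * ε ≤ P.real Bᶜ) (measureReal_mono fun ω hω => ?_)
  obtain ⟨h1, h2, h3, h4⟩ := not_not.1 hω
  obtain ⟨⟨hθ1, hθ2⟩, ⟨hv1, hv2⟩, hs⟩ := hsol _ h1 h2 h3 h4
  exact ⟨hs, abs_le.2 ⟨by unfold catoniAlpha₁ at hθ1; linarith,
    by unfold catoniAlpha₁ at hθ2; linarith⟩, hv1, hv2⟩
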